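/- There is an absolute constant $C$ such that the following holds for all $d\ge 2$ and all $d'$. Let $T$ be a quantum channel (completely positive trace-preserving linear map) from states on $\mathbb{C}^d$ to states on $\mathbb{C}^{d'}$. Let $\tau=(T\otimes\mathrm{id})(|\Omega\rangle\langle\Omega|)$, with $|\Omega\rangle=\frac1{\sqrt d}\sum_{i=1}^d|i\,i\rangle$, be its Choi state, let $\pi=T(\mathbb{I}/d)$, and let $\mathrm{Tr}_2$ be the partial trace over the input copy (second factor) of $\mathbb{C}^{d'}\otimes\mathbb{C}^d$. A unitary $2$-design is a probability measure $\mu$ on $U(d)$ such that $\mathbb{E}_{U\sim\mu}[P(U)]=\mathbb{E}_{U\sim\mu_{\mathrm{Haar}}}[P(U)]$ for every polynomial $P$ of degree at most $2$ in the entries of $U$ and of degree at most $2$ in the entries of $U^\dagger$. Let $\nu$ be a $2$-design over pure states on $\mathbb{C}^d$, i.e. the distribution of $U|\phi_0\rangle\langle\phi_0|U^\dagger$ for some fixed unit vector $|\phi_0\rangle$ and $U$ drawn from some unitary $2$-design. Then two independent states $\rho,\sigma\sim\nu$ are different with positive probability, so that the law $\nu^{(2)}$ of $(\rho,\sigma)\sim\nu\times\nu$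 conditioned on $\rho\neq\sigma$ is well defined, the ratio below is $\nu^{(2)}$-integrable, and the average contraction of the trace distance satisfies $$\eta_1(T,\|\cdot\|_1,\nu^{(2)})=\mathbb{E}_{(\rho,\sigma)\sim\nu^{(2)}}\left[\frac{\frac12\|T(\rho)-T(\sigma)\|_1}{\frac12\|\rho-\sigma\|_1}\right]\;\le\;\frac12\,\mathrm{Tr}\left[\left(\frac{2}{d+1}\left[d\,\mathrm{Tr}_2\tau^2-\pi^2\right]\right)^{1/2}\right]+\frac{C}{\sqrt d}.$$ -/

import Mathlib

noncomputable section

namespace QuantumContraction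

open MeasureTheory Matrix
open scoped ComplexOrder MatrixOrder

/-- The square root of a positive semidefinite complex matrix. -/
def matrixSqrt {n : ℕ} (A : Matrix (Fin n) (Fin n) ℂ) : Matrix (Fin n) (Fin n) ℂ :=
  CFC.sqrt A

/-- The Schatten 1-norm `Tr √(X† X)`, i.e. the sum of the singular values of `X`. -/
def traceNorm {n : ℕ} (X : Matrix (Fin n) (Fin n) ℂ) : ℝ :=
  (matrixSqrt (Xᴴ * X)).trace.re

/-- The set of quantum states on the `d`-dimensional Hilbert space. -/
def DensityMatrix (d : ℕ) : Type :=
  {ρ : Matrix (Fin d) (Fin d) ℂ // ρ.PosSemidef ∧ ρ.trace = 1}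

instance (d : ℕ) : TopologicalSpace (DensityMatrix d) :=
  inferInstanceAs (TopologicalSpace {ρ : Matrix (Fin d) (Fin d) ℂ // ρ.PosSemidef ∧ ρ.trace = 1})

instance (d : ℕ) : MeasurableSpace (DensityMatrix d) := borel _

instance (d : ℕ) : BorelSpace (DensityMatrix d) := ⟨rfl⟩

/-- The trace distance `½ ‖ρ - σ‖₁`. -/
def traceDist (n : ℕ) (ρ σ : DensityMatrix n) : ℝ := 1 / 2 * traceNorm (ρ.1 - σ.1)

/-- The ampliation `T ⊗ id_k`, acting on matrices over `ℂ^d ⊗ ℂ^k`. -/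
def ampliation {d d' : ℕ} (T : Matrix (Fin d) (Fin d) ℂ →ₗ[ℂ] Matrix (Fin d') (Fin d') ℂ) (k : ℕ)
    (X : Matrix (Fin d × Fin k) (Fin d × Fin k) ℂ) :
    Matrix (Fin d' × Fin k) (Fin d' × Fin k) ℂ :=
  Matrix.of fun p q => T (Matrix.of fun i j => X (i, p.2) (j, q.2)) p.1 q.1

/-- Quantum channels: completely positive trace preserving linear maps. -/
structure Channel (d d' : ℕ) where
  toLin : Matrix (Fin d) (Fin d) ℂ →ₗ[ℂ] Matrix (Fin d') (Fin d') ℂ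
  completelyPositive : ∀ (k : ℕ) (X : Matrix (Fin d × Fin k) (Fin d × Fin k) ℂ),
    X.PosSemidef → (ampliation toLin k X).PosSemidef
  tracePreserving : ∀ X, (toLin X).trace = X.trace

theorem Channel.map_posSemidef {d d' : ℕ} (T : Channel d d') {X : Matrix (Fin d) (Fin d) ℂ}
    (hX : X.PosSemidef) : (T.toLin X).PosSemidef :=
  (T.completelyPositive 1 (X.submatrix Prod.fst Prod.fst) (hX.submatrix _)).submatrix
    (fun i : Fin d' => (i, (0 : Fin 1)))

/-- The action of a channel on states. -/
def Channel.onState {d d' : ℕ} (T : Channel d d') (ρ : DensityMatrix d) : DensityMatrix d' :=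
  ⟨T.toLin ρ.1, T.map_posSemidef ρ.2.1, (T.tracePreserving ρ.1).trans ρ.2.2⟩

/-- The maximally entangled vector `d^(-1/2) ∑ i, |i i⟩`. -/
def maxEntangled (d : ℕ) : Fin d × Fin d → ℂ :=
  fun p => if p.1 = p.2 then ((1 / Real.sqrt d : ℝ) : ℂ) else 0

/-- The Choi state `τ = (T ⊗ id)(|Ω⟩⟨Ω|)`. -/
def Channel.choi {d d' : ℕ} (T : Channel d d') : Matrix (Fin d' × Fin d) (Fin d' × Fin d) ℂ :=
  ampliation T.toLin d (vecMulVec (maxEntangled d) (star (maxEntangled d)))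

/-- The image `π = T(𝟙 / d)` of the maximally mixed state. -/
def Channel.avgOutput {d d' : ℕ} (T : Channel d d') : Matrix (Fin d') (Fin d') ℂ :=
  T.toLin ((d : ℂ)⁻¹ • (1 : Matrix (Fin d) (Fin d) ℂ))

/-- The partial trace over the second tensor factor. -/
def partialTraceSnd {m n : ℕ} (X : Matrix (Fin m × Fin n) (Fin m × Fin n) ℂ) :
    Matrix (Fin m) (Fin m) ℂ :=
  Matrix.of fun a b => ∑ i, X (a, i) (b, i)

/-- The unitary group `U(d)`, with its Borel sigma-algebra below. -/
abbrev UGroup (d : ℕ) : Type := Matrix.unitaryGroup (Fin d) ℂ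

instance (d : ℕ) : MeasurableSpace (UGroup d) := borel _

instance (d : ℕ) : BorelSpace (UGroup d) := ⟨rfl⟩

instance (d : ℕ) : CompactSpace (UGroup d) := by
  refine isCompact_iff_compactSpace.mp ?_
  have hc : IsCompact (Set.univ.pi fun _ : Fin d => Set.univ.pi fun _ : Fin d =>
      Metric.closedBall (0 : ℂ) 1) :=
    isCompact_univ_pi fun _ => isCompact_univ_pi fun _ => isCompact_closedBall _ _
  refine hc.of_isClosed_subset ?_ fun U hU i _ j _ => ?_
  · have : ((Matrix.unitaryGroup (Fin d) ℂ : Submonoid (Matrix (Fin d) (Fin d) ℂ)) :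
        Set (Matrix (Fin d) (Fin d) ℂ)) = {U | U * star U = 1} := by
      ext U
      exact Matrix.mem_unitaryGroup_iff
    rw [this]
    exact isClosed_eq (by fun_prop) continuous_const
  · simpa using entry_norm_bound_of_unitary hU i j

/-- The Haar probability measure on `U(d)`. -/
def haarU (d : ℕ) : Measure (UGroup d) := Measure.haarMeasure ⊤

/-- Polynomials in the entries of `U` (left variables) and of `U†` (right variables). -/
abbrev UPolynomial (d : ℕ) : Type := MvPolynomial ((Fin d × Fin d) ⊕ (Fin d × Fin d)) ℂ

/-- Degree at most `t` in the entries of `U` and degree at most `t` in the entries of `U†`. -/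
def UPolynomial.BidegreeLE {d : ℕ} (t : ℕ) (P : UPolynomial d) : Prop :=
  ∀ m ∈ P.support, ∑ x, m (Sum.inl x) ≤ t ∧ ∑ x, m (Sum.inr x) ≤ t

/-- The value of a polynomial at a unitary. -/
def UPolynomial.evalAt {d : ℕ} (P : UPolynomial d) (U : UGroup d) : ℂ :=
  MvPolynomial.eval (Sum.elim (fun x => U.1 x.1 x.2) (fun x => U.1ᴴ x.1 x.2)) P

/-- Unitary `t`-designs. -/
def IsUnitaryDesign {d : ℕ} (t : ℕ) (μ : Measure (UGroup d)) : Prop :=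
  IsProbabilityMeasure μ ∧ ∀ P : UPolynomial d, P.BidegreeLE t →
    ∫ U, P.evalAt U ∂μ = ∫ U, P.evalAt U ∂(haarU d)

/-- The pure state `|ψ⟩⟨ψ|` of a unit vector `ψ`. -/
def pureState {d : ℕ} (ψ : Fin d → ℂ) (hψ : ψ ⬝ᵥ star ψ = 1) : DensityMatrix d :=
  ⟨vecMulVec ψ (star ψ), posSemidef_vecMulVec_self_star ψ, by rw [trace_vecMulVec, hψ]⟩

theorem mulVec_unit {d : ℕ} (U : UGroup d) (φ : Fin d → ℂ) (hφ : φ ⬝ᵥ star φ = 1) :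
    (U.1 *ᵥ φ) ⬝ᵥ star (U.1 *ᵥ φ) = 1 := by
  have h : U.1ᴴ * U.1 = 1 := Matrix.mem_unitaryGroup_iff'.mp U.2
  rw [star_mulVec, dotProduct_comm, ← dotProduct_mulVec, mulVec_mulVec, h, one_mulVec,
    dotProduct_comm, hφ]

/-- The state `U|φ⟩⟨φ|U†`. -/
def orbitState {d : ℕ} (φ : Fin d → ℂ) (hφ : φ ⬝ᵥ star φ = 1) (U : UGroup d) : DensityMatrix d :=
  pureState (U.1 *ᵥ φ) (mulVec_unit U φ hφ)

/-- State `t`-designs, as distributions of pure states: the distribution of `U|φ⟩⟨φ|U†` for a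
fixed unit vector `φ` and `U` drawn from a unitary `t`-design. -/
def IsStateDesign {d : ℕ} (t : ℕ) (ν : Measure (DensityMatrix d)) : Prop :=
  ∃ (φ : Fin d → ℂ) (hφ : φ ⬝ᵥ star φ = 1) (μ : Measure (UGroup d)),
    IsUnitaryDesign t μ ∧ ν = μ.map (orbitState φ hφ)

/-- The law of a pair of independent states drawn from `ν`, conditioned on being different. -/
def distinctPair {d : ℕ} (ν : Measure (DensityMatrix d)) :
    Measure (DensityMatrix d × DensityMatrix d) :=
  ProbabilityTheory.cond (ν.prod ν) {q | q.1 ≠ q.2}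

/-- The ratio `D(T(ρ), T(σ)) / D(ρ, σ)` for a (finite) divergence `D`. -/
def contractionRatio (D : ∀ n : ℕ, DensityMatrix n → DensityMatrix n → ℝ) {d d' : ℕ}
    (T : Channel d d') (q : DensityMatrix d × DensityMatrix d) : ℝ :=
  D d' (T.onState q.1) (T.onState q.2) / D d q.1 q.2

/-- The `p`-th moment of contraction `η_p(T, D, ν)`; `p = 1` is the average contraction. -/
def contractionMoment (p : ℝ) {d d' : ℕ} (T : Channel d d')
    (D : ∀ n : ℕ, DensityMatrix n → DensityMatrix n → ℝ)
    (ν : Measure (DensityMatrix d × DensityMatrix d)) : ℝ :=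
  (∫ q, contractionRatio D T q ^ p ∂ν) ^ (1 / p)

end QuantumContraction

end

open QuantumContraction MeasureTheory

/-!
For independent `ρ, σ` drawn from a 2-design, `E[T(ρ - σ)²]` only involves the second moment
`E[ρ ⊗ ρ] = (1 + SWAP) / (d (d + 1))`, and equals `(2 / (d + 1)) (d Tr₂ τ² - π²)`. Since
`X ↦ Tr √X` is concave, Jensen's inequality bounds `E ‖T(ρ - σ)‖₁` by the trace of the square root
of this matrix.

Passing from `T(ρ - σ)` to the ratio costs little because `D = ½ ‖ρ - σ‖₁` is nearly constant. For
a traceless Hermitian `X` one has `2 Tr X² ≤ ‖X‖₁²`, so `E[1 - D²] ≤ 1 - ½ E Tr (ρ - σ)² = 1 / d`,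
while `a / D ≤ a + (1 - D)` whenever `0 ≤ a ≤ D ≤ 1`. As `D = 0` when `ρ = σ`, Markov's inequality
bounds the probability of this event by `1 / d`, so conditioning on `ρ ≠ σ` costs another `1 / d`.
-/

namespace QuantumContraction

open Matrix
open scoped ComplexOrder MatrixOrder

section TraceNorm

theorem trace_cfc {𝕜 m : Type*} [RCLike 𝕜] [Fintype m] [DecidableEq m] {A : Matrix m m 𝕜}
    (hA : A.IsHermitian) (f : ℝ → ℝ) : (cfc f A).trace = ∑ i, (f (hA.eigenvalues i) : 𝕜) := by
  rw [hA.cfc_eq, IsHermitian.cfc, Unitary.conjStarAlgAut_apply, trace_mul_cycle,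
    Unitary.coe_star_mul_self, Matrix.one_mul, trace_diagonal]
  rfl

theorem sum_star_eigenvectorBasis_dotProduct_mulVec {𝕜 m : Type*} [RCLike 𝕜] [Fintype m]
    [DecidableEq m] {A : Matrix m m 𝕜} (hA : A.IsHermitian) (B : Matrix m m 𝕜) :
    ∑ i, star ⇑(hA.eigenvectorBasis i) ⬝ᵥ B *ᵥ ⇑(hA.eigenvectorBasis i) = B.trace := by
  let U := hA.eigenvectorUnitary
  calc ∑ i, star ⇑(hA.eigenvectorBasis i) ⬝ᵥ B *ᵥ ⇑(hA.eigenvectorBasis i)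
      = (star (U : Matrix m m 𝕜) * (B * U)).trace := rfl
    _ = B.trace := by
      rw [trace_mul_comm, Matrix.mul_assoc, Unitary.mul_star_self_of_mem U.2,
        Matrix.mul_one]

variable {n : ℕ} {A B X : Matrix (Fin n) (Fin n) ℂ}

theorem traceNorm_nonneg (X : Matrix (Fin n) (Fin n) ℂ) : 0 ≤ traceNorm X :=
  (Complex.le_def.1 (nonneg_iff_posSemidef.1 (CFC.sqrt_nonneg (Xᴴ * X))).trace_nonneg).1

theorem traceNorm_zero : traceNorm (0 : Matrix (Fin n) (Fin n) ℂ) = 0 := by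
  simp [traceNorm, matrixSqrt]

theorem traceNorm_eq_trace_abs (X : Matrix (Fin n) (Fin n) ℂ) :
    traceNorm X = (CFC.abs X).trace.re :=
  rfl

theorem traceNorm_eq_trace_posPart_add_trace_negPart (hX : X.IsHermitian) :
    traceNorm X = X⁺.trace.re + X⁻.trace.re := by
  rw [traceNorm_eq_trace_abs, ← CFC.posPart_add_negPart X hX.isSelfAdjoint, trace_add,
    Complex.add_re]

theorem traceNorm_eq_sum_abs_eigenvalues (hX : X.IsHermitian) :
    traceNorm X = ∑ i, |hX.eigenvalues i| := by
  rw [traceNorm_eq_trace_abs, CFC.abs_eq_cfc_norm X hX.isSelfAdjoint, trace_cfc hX, Complex.re_sum]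
  rfl

theorem traceNorm_sub_le (hA : A.PosSemidef) (hB : B.PosSemidef) :
    traceNorm (A - B) ≤ A.trace.re + B.trace.re := by
  have hX : (A - B).IsHermitian := hA.1.sub hB.1
  rw [traceNorm_eq_sum_abs_eigenvalues hX, ← sum_star_eigenvectorBasis_dotProduct_mulVec hX A,
    ← sum_star_eigenvectorBasis_dotProduct_mulVec hX B, Complex.re_sum, Complex.re_sum,
    ← Finset.sum_add_distrib]
  refine Finset.sum_le_sum fun i _ => ?_
  rw [hX.eigenvalues_eq, sub_mulVec, dotProduct_sub, map_sub]
  refine (abs_sub _ _).trans_eq ?_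
  rw [abs_of_nonneg (hA.re_dotProduct_nonneg _), abs_of_nonneg (hB.re_dotProduct_nonneg _)]
  rfl

theorem two_mul_sum_sq_le_sq_sum_abs {ι : Type*} {s : Finset ι} {x : ι → ℝ}
    (hx : ∑ i ∈ s, x i = 0) : 2 * ∑ i ∈ s, x i ^ 2 ≤ (∑ i ∈ s, |x i|) ^ 2 := by
  classical
  have two_mul_abs_le (i) (hi : i ∈ s) : 2 * |x i| ≤ ∑ j ∈ s, |x j| := by
    rw [← Finset.add_sum_erase s x hi] at hx
    rw [← Finset.add_sum_erase s (|x ·|) hi, two_mul, eq_neg_of_add_eq_zero_left hx, abs_neg]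
    gcongr
    exact Finset.abs_sum_le_sum_abs _ _
  calc 2 * ∑ i ∈ s, x i ^ 2 = ∑ i ∈ s, |x i| * (2 * |x i|) := by
        rw [Finset.mul_sum]
        exact Finset.sum_congr rfl fun i _ => by rw [← sq_abs]; ring
    _ ≤ ∑ i ∈ s, |x i| * ∑ j ∈ s, |x j| := by
        gcongr with i hi
        exact two_mul_abs_le i hi
    _ = (∑ i ∈ s, |x i|) ^ 2 := by rw [← Finset.sum_mul, sq]

theorem two_mul_trace_sq_le_sq_traceNorm (hX : X.IsHermitian) (h0 : X.trace = 0) :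
    2 * (X * X).trace.re ≤ traceNorm X ^ 2 := by
  have sum_eigenvalues : ∑ i, hX.eigenvalues i = 0 := by
    simpa [h0] using (congrArg Complex.re hX.trace_eq_sum_eigenvalues).symm
  have trace_sq : (X * X).trace.re = ∑ i, hX.eigenvalues i ^ 2 := by
    rw [← sq, ← cfc_pow_id (R := ℝ) X 2 hX.isSelfAdjoint, trace_cfc hX, Complex.re_sum]
    rfl
  rw [traceNorm_eq_sum_abs_eigenvalues hX, trace_sq]
  exact two_mul_sum_sq_le_sq_sum_abs sum_eigenvalues

section Jensen

open scoped Matrix.Norms.L2Operator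

theorem continuousOn_re_trace_matrixSqrt (n : ℕ) :
    ContinuousOn (fun A : Matrix (Fin n) (Fin n) ℂ => (matrixSqrt A).trace.re) {A | 0 ≤ A} :=
  have : Continuous fun A : Matrix (Fin n) (Fin n) ℂ => A.trace.re := by fun_prop
  this.comp_continuousOn CFC.continuousOn_sqrt

theorem concaveOn_re_trace_matrixSqrt (n : ℕ) :
    ConcaveOn ℝ {A : Matrix (Fin n) (Fin n) ℂ | 0 ≤ A} fun A => (matrixSqrt A).trace.re := by
  have sqrt_concave := CFC.concaveOn_sqrt (A := Matrix (Fin n) (Fin n) ℂ)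
  refine ⟨sqrt_concave.1, fun x hx y hy a b ha hb hab => ?_⟩
  have := nonneg_iff_posSemidef.1 (sub_nonneg.2 (sqrt_concave.2 hx hy ha hb hab))
  have := (Complex.le_def.1 this.trace_nonneg).1
  simpa [matrixSqrt] using this

theorem integral_re_trace_matrixSqrt_le {Ω : Type*} [MeasurableSpace Ω] {m : Measure Ω}
    [IsProbabilityMeasure m] {F : Ω → Matrix (Fin n) (Fin n) ℂ} (hF : ∀ ω, 0 ≤ F ω)
    (hFi : Integrable F m) (hFs : Integrable (fun ω => (matrixSqrt (F ω)).trace.re) m) :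
    ∫ ω, (matrixSqrt (F ω)).trace.re ∂m ≤ (matrixSqrt (∫ ω, F ω ∂m)).trace.re :=
  (concaveOn_re_trace_matrixSqrt n).le_map_integral (continuousOn_re_trace_matrixSqrt n)
    CStarAlgebra.isClosed_nonneg (Filter.Eventually.of_forall hF) hFi hFs

end Jensen

@[fun_prop]
theorem continuous_traceNorm : Continuous (traceNorm : Matrix (Fin n) (Fin n) ℂ → ℝ) :=
  (continuousOn_re_trace_matrixSqrt n).comp_continuous
    (f := fun X : Matrix (Fin n) (Fin n) ℂ => Xᴴ * X) (by fun_prop)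
    fun X => nonneg_iff_posSemidef.2 (posSemidef_conjTranspose_mul_self X)

end TraceNorm

section PositiveMaps

variable {d d' : ℕ}

/-- Positive trace-preserving linear maps between matrix algebras: the property of a quantum
channel on which the contraction estimate rests. -/
structure IsPositiveTracePreserving
    (T : Matrix (Fin d) (Fin d) ℂ →ₗ[ℂ] Matrix (Fin d') (Fin d') ℂ) : Prop where
  map_posSemidef : ∀ {X}, X.PosSemidef → (T X).PosSemidef
  trace_map : ∀ X, (T X).trace = X.trace

theorem Channel.isPositiveTracePreserving (T : Channel d d') :
    IsPositiveTracePreserving T.toLin :=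
  ⟨T.map_posSemidef, T.tracePreserving⟩

namespace IsPositiveTracePreserving

variable {T : Matrix (Fin d) (Fin d) ℂ →ₗ[ℂ] Matrix (Fin d') (Fin d') ℂ}

theorem traceNorm_map_le (hT : IsPositiveTracePreserving T) {X : Matrix (Fin d) (Fin d) ℂ}
    (hX : X.IsHermitian) : traceNorm (T X) ≤ traceNorm X := by
  have posPart_posSemidef := nonneg_iff_posSemidef.1 (CFC.posPart_nonneg X)
  have negPart_posSemidef := nonneg_iff_posSemidef.1 (CFC.negPart_nonneg X)
  calc traceNorm (T X) = traceNorm (T X⁺ - T X⁻) := by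
        rw [← map_sub, CFC.posPart_sub_negPart X hX.isSelfAdjoint]
    _ ≤ (T X⁺).trace.re + (T X⁻).trace.re :=
        traceNorm_sub_le (hT.map_posSemidef posPart_posSemidef)
          (hT.map_posSemidef negPart_posSemidef)
    _ = traceNorm X := by
        rw [hT.trace_map, hT.trace_map, traceNorm_eq_trace_posPart_add_trace_negPart hX]

theorem isHermitian_map_sub (hT : IsPositiveTracePreserving T) (ρ σ : DensityMatrix d) :
    (T (ρ.1 - σ.1)).IsHermitian := by
  rw [map_sub]
  exact (hT.map_posSemidef ρ.2.1).1.sub (hT.map_posSemidef σ.2.1).1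

end IsPositiveTracePreserving

end PositiveMaps

section DensityMatrix

variable {d : ℕ}

local instance : SecondCountableTopology (Matrix (Fin d) (Fin d) ℂ) :=
  inferInstanceAs (SecondCountableTopology (Fin d → Fin d → ℂ))

instance : SecondCountableTopology (UGroup d) :=
  TopologicalSpace.Subtype.secondCountableTopology _

namespace DensityMatrix

instance : T2Space (DensityMatrix d) :=
  inferInstanceAs (T2Space {ρ : Matrix (Fin d) (Fin d) ℂ // ρ.PosSemidef ∧ ρ.trace = 1})

instance : SecondCountableTopology (DensityMatrix d) :=
  TopologicalSpace.Subtype.secondCountableTopology _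

@[fun_prop]
theorem continuous_val {X : Type*} [TopologicalSpace X] {f : X → DensityMatrix d}
    (hf : Continuous f) : Continuous fun x => (f x).1 :=
  continuous_subtype_val.comp hf

@[fun_prop]
theorem continuous_apply {X : Type*} [TopologicalSpace X] {f : X → DensityMatrix d}
    (hf : Continuous f) (a b : Fin d) : Continuous fun x => (f x).1 a b :=
  (continuous_val hf).matrix_elem a b

section Compact

open scoped Matrix.Norms.Frobenius

theorem trace_conjTranspose_mul_self_eq_norm_sq {m n : Type*} [Fintype m] [Fintype n]
    (C : Matrix m n ℂ) : (Cᴴ * C).trace = ((‖C‖ ^ 2 : ℝ) : ℂ) := by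
  rw [frobenius_norm_def, ← Real.sqrt_eq_rpow, Real.sq_sqrt (by positivity), Finset.sum_comm]
  simp [trace, mul_apply, Complex.conj_mul']

theorem image_conjTranspose_mul_self_sphere :
    (fun C : Matrix (Fin d) (Fin d) ℂ => Cᴴ * C) '' Metric.sphere 0 1 =
      {ρ | ρ.PosSemidef ∧ ρ.trace = 1} := by
  have mem_sphere (C : Matrix (Fin d) (Fin d) ℂ) :
      C ∈ Metric.sphere 0 1 ↔ (Cᴴ * C).trace = 1 := by
    rw [trace_conjTranspose_mul_self_eq_norm_sq, mem_sphere_zero_iff_norm, Complex.ofReal_eq_one,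
      pow_eq_one_iff_of_nonneg (norm_nonneg C) two_ne_zero]
  ext ρ
  constructor
  · rintro ⟨C, hC, rfl⟩
    exact ⟨posSemidef_conjTranspose_mul_self C, (mem_sphere C).1 hC⟩
  · rintro ⟨hρ, trace_eq_one⟩
    obtain ⟨C, rfl⟩ := CStarAlgebra.nonneg_iff_eq_star_mul_self.1 hρ.nonneg
    exact ⟨C, (mem_sphere C).2 trace_eq_one, rfl⟩

instance : CompactSpace (DensityMatrix d) := by
  have : ProperSpace (Matrix (Fin d) (Fin d) ℂ) := FiniteDimensional.proper ℂ _
  have compact_image := (isCompact_sphere (0 : Matrix (Fin d) (Fin d) ℂ) 1).image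
    (f := fun C => Cᴴ * C) (by fun_prop)
  rw [image_conjTranspose_mul_self_sphere] at compact_image
  exact isCompact_iff_compactSpace.1 compact_image

end Compact

end DensityMatrix

end DensityMatrix

section TwoDesign

section MatrixUnits

variable {R E m n : Type*} [CommSemiring R] [Fintype m] [Fintype n] [DecidableEq m]
  [DecidableEq n] [AddCommMonoid E] [Module R E]

theorem map_eq_sum_smul_single (L : Matrix m n R →ₗ[R] E) (X : Matrix m n R) :
    L X = ∑ p : m × n, X p.1 p.2 • L (single p.1 p.2 1) := by
  conv_lhs => rw [matrix_eq_sum_single X]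
  simp only [map_sum, ← map_smul, smul_single, smul_eq_mul, mul_one, Fintype.sum_prod_type]

theorem map_map_eq_sum_smul_single (B : Matrix m n R →ₗ[R] Matrix m n R →ₗ[R] E)
    (X Y : Matrix m n R) :
    B X Y = ∑ p : (m × n) × (m × n), (X p.1.1 p.1.2 * Y p.2.1 p.2.2) •
      B (single p.1.1 p.1.2 1) (single p.2.1 p.2.2 1) := by
  rw [Fintype.sum_prod_type, map_eq_sum_smul_single B X, LinearMap.sum_apply]
  refine Finset.sum_congr rfl fun p _ => ?_
  rw [LinearMap.smul_apply, map_eq_sum_smul_single (B (single p.1 p.2 1)) Y]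
  simp only [Finset.smul_sum, smul_smul]

end MatrixUnits

theorem integrable_of_continuous {X E : Type*} [TopologicalSpace X] [CompactSpace X]
    [MeasurableSpace X] [OpensMeasurableSpace X] [SecondCountableTopology X]
    [NormedAddCommGroup E] {m : Measure X} [IsFiniteMeasure m] {f : X → E} (hf : Continuous f) :
    Integrable f m :=
  hf.integrable_of_hasCompactSupport (HasCompactSupport.of_compactSpace f)

theorem integral_sum_smul_const {X ι E : Type*} [TopologicalSpace X] [CompactSpace X]
    [MeasurableSpace X] [OpensMeasurableSpace X] [SecondCountableTopology X] [Fintype ι]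
    [NormedAddCommGroup E] [NormedSpace ℂ E] [CompleteSpace E] {m : Measure X}
    [IsFiniteMeasure m] {c : ι → X → ℂ} (hc : ∀ i, Continuous (c i)) (e : ι → E) :
    ∫ x, ∑ i, c i x • e i ∂m = ∑ i, (∫ x, c i x ∂m) • e i := by
  rw [integral_finsetSum _ fun i _ => integrable_of_continuous (by fun_prop)]
  simp only [integral_smul_const]

theorem integral_prod_sub_mul_sub {𝕜 X : Type*} [RCLike 𝕜] [MeasurableSpace X] {m : Measure X}
    [IsProbabilityMeasure m] {f g : X → 𝕜} (hf : Integrable f m) (hg : Integrable g m)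
    (hfg : Integrable (fun x => f x * g x) m) :
    ∫ q, (f q.1 - f q.2) * (g q.1 - g q.2) ∂(m.prod m) =
      2 * (∫ x, f x * g x ∂m - (∫ x, f x ∂m) * ∫ x, g x ∂m) := by
  have diagonal_integrable : Integrable (fun q : X × X => f q.1 * g q.1 + f q.2 * g q.2)
      (m.prod m) := (hfg.comp_fst m).add (hfg.comp_snd m)
  have cross_integrable : Integrable (fun q : X × X => f q.1 * g q.2 + g q.1 * f q.2)
      (m.prod m) := (hf.mul_prod hg).add (hg.mul_prod hf)
  calc ∫ q, (f q.1 - f q.2) * (g q.1 - g q.2) ∂(m.prod m)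
      = ∫ q, f q.1 * g q.1 + f q.2 * g q.2 - (f q.1 * g q.2 + g q.1 * f q.2) ∂(m.prod m) := by
        congr with q
        ring
    _ = 2 * (∫ x, f x * g x ∂m - (∫ x, f x ∂m) * ∫ x, g x ∂m) := by
        rw [integral_sub diagonal_integrable cross_integrable,
          integral_add (hfg.comp_fst m) (hfg.comp_snd m),
          integral_add (hf.mul_prod hg) (hg.mul_prod hf), integral_prod_mul, integral_prod_mul,
          integral_fun_fst fun x => f x * g x, integral_fun_snd fun x => f x * g x]
        simp only [probReal_univ, one_smul]
        ring

variable {d : ℕ}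

/-- Projective 2-designs: probability measures on states whose second moment `E[ρ ⊗ ρ]` is
`(1 + SWAP) / (d (d + 1))`, the value for Haar random pure states. -/
structure IsProjectiveTwoDesign (ν : Measure (DensityMatrix d)) : Prop where
  isProbabilityMeasure : IsProbabilityMeasure ν
  integral_mul : ∀ a b c e, ∫ ρ, ρ.1 a b * ρ.1 c e ∂ν =
    ((1 : Matrix (Fin d) (Fin d) ℂ) a b * (1 : Matrix (Fin d) (Fin d) ℂ) c e +
      (1 : Matrix (Fin d) (Fin d) ℂ) a e * (1 : Matrix (Fin d) (Fin d) ℂ) c b) / (d * (d + 1))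

namespace IsProjectiveTwoDesign

variable {ν : Measure (DensityMatrix d)}

theorem dim_ne_zero (hν : IsProjectiveTwoDesign ν) : d ≠ 0 := by
  rintro rfl
  have := hν.isProbabilityMeasure
  obtain ⟨ρ⟩ := ν.nonempty_of_neZero
  simpa [trace] using ρ.2.2

theorem integral_apply (hν : IsProjectiveTwoDesign ν) (a b : Fin d) :
    ∫ ρ, ρ.1 a b ∂ν = (1 : Matrix (Fin d) (Fin d) ℂ) a b / d := by
  have := hν.isProbabilityMeasure
  have := hν.dim_ne_zero
  have hd : (d : ℂ) + 1 ≠ 0 := by exact_mod_cast d.succ_ne_zero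
  calc ∫ ρ, ρ.1 a b ∂ν = ∫ ρ, ∑ c, ρ.1 a b * ρ.1 c c ∂ν := by
        refine integral_congr_ae (.of_forall fun ρ => ?_)
        have trace_eq_one : ∑ c, ρ.1 c c = 1 := ρ.2.2
        simp only [← Finset.mul_sum, trace_eq_one, mul_one]
    _ = ∑ c, ∫ ρ, ρ.1 a b * ρ.1 c c ∂ν :=
        integral_finsetSum _ fun c _ => integrable_of_continuous (by fun_prop)
    _ = (1 : Matrix (Fin d) (Fin d) ℂ) a b / d := by
        have mul_one_apply : ∑ c, (1 : Matrix (Fin d) (Fin d) ℂ) a c * (1 : Matrix _ _ ℂ) c b =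
            (1 : Matrix _ _ ℂ) a b := by rw [← mul_apply, Matrix.mul_one]
        simp [hν.integral_mul, ← Finset.sum_div, Finset.sum_add_distrib, mul_one_apply]
        field_simp

theorem integral_sub_mul_sub (hν : IsProjectiveTwoDesign ν) (a b c e : Fin d) :
    ∫ q, (q.1.1 a b - q.2.1 a b) * (q.1.1 c e - q.2.1 c e) ∂(ν.prod ν) =
      2 / ((d : ℂ) * (d + 1)) *
        ((1 : Matrix (Fin d) (Fin d) ℂ) a e * (1 : Matrix (Fin d) (Fin d) ℂ) c b -
          (d : ℂ)⁻¹ *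
            ((1 : Matrix (Fin d) (Fin d) ℂ) a b * (1 : Matrix (Fin d) (Fin d) ℂ) c e)) := by
  have := hν.isProbabilityMeasure
  have := hν.dim_ne_zero
  have hd : (d : ℂ) + 1 ≠ 0 := by exact_mod_cast d.succ_ne_zero
  rw [integral_prod_sub_mul_sub (f := fun ρ : DensityMatrix d => ρ.1 a b)
    (g := fun ρ : DensityMatrix d => ρ.1 c e) (integrable_of_continuous (by fun_prop))
    (integrable_of_continuous (by fun_prop)) (integrable_of_continuous (by fun_prop)),
    hν.integral_mul, hν.integral_apply, hν.integral_apply]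
  field_simp
  ring

variable {E : Type*} [NormedAddCommGroup E] [NormedSpace ℂ E] [CompleteSpace E]

theorem integral_map_map_sub_sub (hν : IsProjectiveTwoDesign ν)
    (B : Matrix (Fin d) (Fin d) ℂ →ₗ[ℂ] Matrix (Fin d) (Fin d) ℂ →ₗ[ℂ] E) :
    ∫ q, B (q.1.1 - q.2.1) (q.1.1 - q.2.1) ∂(ν.prod ν) = (2 / ((d : ℂ) * (d + 1))) •
      (∑ a, ∑ b, B (single a b 1) (single b a 1) - (d : ℂ)⁻¹ • B 1 1) := by
  have := hν.isProbabilityMeasure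
  have sum_swap : ∑ a, ∑ b, B (single a b 1) (single b a 1) =
      ∑ p : (Fin d × Fin d) × (Fin d × Fin d),
        ((1 : Matrix _ _ ℂ) p.1.1 p.2.2 * (1 : Matrix _ _ ℂ) p.2.1 p.1.2) •
          B (single p.1.1 p.1.2 1) (single p.2.1 p.2.2 1) := by
    simp only [Fintype.sum_prod_type, one_apply, mul_smul, ite_smul, one_smul, zero_smul,
      Finset.sum_ite_eq, Finset.sum_ite_eq', Finset.mem_univ, if_true]
  calc ∫ q, B (q.1.1 - q.2.1) (q.1.1 - q.2.1) ∂(ν.prod ν)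
      = ∫ q, ∑ p : (Fin d × Fin d) × (Fin d × Fin d),
          ((q.1.1 p.1.1 p.1.2 - q.2.1 p.1.1 p.1.2) * (q.1.1 p.2.1 p.2.2 - q.2.1 p.2.1 p.2.2)) •
            B (single p.1.1 p.1.2 1) (single p.2.1 p.2.2 1) ∂(ν.prod ν) :=
        integral_congr_ae (.of_forall fun q => map_map_eq_sum_smul_single B _ _)
    _ = _ := by
        rw [integral_sum_smul_const fun p => by fun_prop, sum_swap,
          map_map_eq_sum_smul_single B 1 1, Finset.smul_sum, ← Finset.sum_sub_distrib,
          Finset.smul_sum]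
        simp only [hν.integral_sub_mul_sub, ← sub_smul, smul_smul]

end IsProjectiveTwoDesign

end TwoDesign

section SecondMoment

variable {d : ℕ}

/-- Probability measures on states whose second moment `E[ρ ⊗ ρ]` commutes with `V ⊗ V` for every
unitary `V` and is fixed by exchanging the row indices of the two factors, as it is for a
unitarily invariant distribution of pure states. -/
structure HasInvariantSymmetricSecondMoment (ν : Measure (DensityMatrix d)) : Prop where
  isProbabilityMeasure : IsProbabilityMeasure ν
  integral_conj_mul_conj : ∀ (V : UGroup d) (a b c e : Fin d),
    ∫ ρ, (V.1 * ρ.1 * V.1ᴴ) a b * (V.1 * ρ.1 * V.1ᴴ) c e ∂ν = ∫ ρ, ρ.1 a b * ρ.1 c e ∂ν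
  integral_mul_swap : ∀ a b c e : Fin d,
    ∫ ρ, ρ.1 a b * ρ.1 c e ∂ν = ∫ ρ, ρ.1 c b * ρ.1 a e ∂ν

theorem diagonal_mem_unitaryGroup {n α : Type*} [Fintype n] [DecidableEq n] [CommRing α]
    [StarRing α] {v : n → α} (hv : ∀ i, v i * star (v i) = 1) :
    diagonal v ∈ unitaryGroup n α := by
  rw [mem_unitaryGroup_iff, star_eq_conjTranspose, diagonal_conjTranspose, diagonal_mul_diagonal]
  simp [hv]

/-- The square root `((1 + i) + (1 - i) S) / 2` of the transposition matrix `S` of `a` and `c`. -/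
noncomputable def sqrtSwap (a c : Fin d) : Matrix (Fin d) (Fin d) ℂ :=
  ((1 + Complex.I) / 2) • 1 + ((1 - Complex.I) / 2) • swap ℂ a c

theorem conjTranspose_sqrtSwap (a c : Fin d) : (sqrtSwap a c)ᴴ =
    ((1 - Complex.I) / 2) • 1 + ((1 + Complex.I) / 2) • swap ℂ a c := by
  simp [sqrtSwap, sub_eq_add_neg]

theorem sqrtSwap_mem_unitaryGroup (a c : Fin d) : sqrtSwap a c ∈ unitaryGroup (Fin d) ℂ := by
  rw [mem_unitaryGroup_iff, star_eq_conjTranspose, conjTranspose_sqrtSwap, sqrtSwap]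
  simp only [add_mul, mul_add, smul_mul_smul_comm, swap_mul_self, Matrix.mul_one, Matrix.one_mul]
  match_scalars <;> ring_nf <;> norm_num

theorem sqrtSwap_conj_apply_self (a c : Fin d) (X : Matrix (Fin d) (Fin d) ℂ) :
    (sqrtSwap a c * X * (sqrtSwap a c)ᴴ) a a =
      (X a a + X c c + Complex.I * (X a c - X c a)) / 2 := by
  rw [conjTranspose_sqrtSwap, sqrtSwap]
  simp only [add_mul, mul_add, smul_mul_assoc, mul_smul_comm,
    Matrix.mul_one, Matrix.one_mul, Matrix.add_apply, Matrix.smul_apply, smul_eq_mul,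
    swap_mul_apply_left, mul_swap_apply_left]
  linear_combination (X a c + X c a - X a a - X c c) / 4 * Complex.I_sq

namespace HasInvariantSymmetricSecondMoment

variable {ν : Measure (DensityMatrix d)}

theorem integral_mul_eq_zero (hν : HasInvariantSymmetricSecondMoment ν) {a b c e : Fin d}
    (h₁ : ¬(a = b ∧ c = e)) (h₂ : ¬(a = e ∧ c = b)) :
    ∫ ρ, ρ.1 a b * ρ.1 c e ∂ν = 0 := by
  -- Conjugation by `diag(1, …, i, …, 1)` multiplies the moment by a power of `i`, whose exponent is
  -- the excess of the marked index among the row indices over the column indices.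
  have phase (j : Fin d) : ∫ ρ, ρ.1 a b * ρ.1 c e ∂ν =
      (if a = j then Complex.I else 1) * (if c = j then Complex.I else 1) *
        ((if b = j then -Complex.I else 1) * (if e = j then -Complex.I else 1)) *
          ∫ ρ, ρ.1 a b * ρ.1 c e ∂ν := by
    have phase_mem := diagonal_mem_unitaryGroup (v := fun i => if i = j then Complex.I else 1)
      fun i => by split <;> simp
    rw [← integral_const_mul, ← hν.integral_conj_mul_conj ⟨_, phase_mem⟩]
    congr with ρ
    simp only [diagonal_conjTranspose, diagonal_mul, mul_diagonal, Pi.star_apply, apply_ite star,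
      RCLike.star_def, Complex.conj_I, star_one]
    ring
  by_contra moment_ne_zero
  have phase_eq_one (j : Fin d) := (right_eq_mul₀ moment_ne_zero).1 (phase j)
  grind [phase_eq_one a, phase_eq_one c, Complex.I_mul_I]

theorem integral_sq_eq (hν : HasInvariantSymmetricSecondMoment ν) {a c : Fin d} (hac : a ≠ c) :
    4 * ∫ ρ, ρ.1 a a * ρ.1 a a ∂ν = ∫ ρ, ρ.1 a a * ρ.1 a a ∂ν + ∫ ρ, ρ.1 c c * ρ.1 c c ∂ν +
      4 * ∫ ρ, ρ.1 a a * ρ.1 c c ∂ν := by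
  have := hν.isProbabilityMeasure
  have zero (x y z w : Fin d) := hν.integral_mul_eq_zero (a := x) (b := y) (c := z) (e := w)
  have comm : ∫ ρ, ρ.1 c c * ρ.1 a a ∂ν = ∫ ρ, ρ.1 a a * ρ.1 c c ∂ν := by
    simp only [mul_comm]
  calc 4 * ∫ ρ, ρ.1 a a * ρ.1 a a ∂ν
      = ∫ ρ, 4 * ((sqrtSwap a c * ρ.1 * (sqrtSwap a c)ᴴ) a a *
          (sqrtSwap a c * ρ.1 * (sqrtSwap a c)ᴴ) a a) ∂ν := by
        rw [integral_const_mul, hν.integral_conj_mul_conj ⟨_, sqrtSwap_mem_unitaryGroup a c⟩]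
    _ = ∫ ρ, (ρ.1 a a * ρ.1 a a + ρ.1 c c * ρ.1 c c + 2 * (ρ.1 a a * ρ.1 c c) +
          2 * (ρ.1 a c * ρ.1 c a) - ρ.1 a c * ρ.1 a c - ρ.1 c a * ρ.1 c a +
          2 * Complex.I * (ρ.1 a a * ρ.1 a c) - 2 * Complex.I * (ρ.1 a a * ρ.1 c a) +
          2 * Complex.I * (ρ.1 c c * ρ.1 a c) - 2 * Complex.I * (ρ.1 c c * ρ.1 c a)) ∂ν := by
        congr with ρ
        rw [sqrtSwap_conj_apply_self]
        linear_combination (ρ.1 a c - ρ.1 c a) ^ 2 * Complex.I_sq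
    _ = _ := by
        rw [integral_sub, integral_add, integral_sub, integral_add, integral_sub, integral_sub,
          integral_add, integral_add, integral_add]
        · simp only [integral_const_mul]
          rw [hν.integral_mul_swap a c c a, comm, zero a c a c, zero c a c a, zero a a a c,
            zero a a c a, zero c c a c, zero c c c a]
          · ring
          all_goals simp [hac, hac.symm]
        all_goals exact integrable_of_continuous (by fun_prop)

theorem integral_sq_eq_two_mul (hν : HasInvariantSymmetricSecondMoment ν) {a c : Fin d}
    (hac : a ≠ c) : ∫ ρ, ρ.1 a a * ρ.1 a a ∂ν = 2 * ∫ ρ, ρ.1 c c * ρ.1 a a ∂ν := by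
  have comm : ∫ ρ, ρ.1 a a * ρ.1 c c ∂ν = ∫ ρ, ρ.1 c c * ρ.1 a a ∂ν := by
    simp only [mul_comm]
  linear_combination
    (3 * hν.integral_sq_eq hac + hν.integral_sq_eq hac.symm + 12 * comm) / 8

theorem integral_diag_mul_diag_eq_half_mul (hν : HasInvariantSymmetricSecondMoment ν)
    (x a c : Fin d) : ∫ ρ, ρ.1 a a * ρ.1 c c ∂ν =
      (1 + (1 : Matrix (Fin d) (Fin d) ℂ) a c) / 2 * ∫ ρ, ρ.1 x x * ρ.1 x x ∂ν := by
  have sq_eq (y z : Fin d) : ∫ ρ, ρ.1 y y * ρ.1 y y ∂ν = ∫ ρ, ρ.1 z z * ρ.1 z z ∂ν := by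
    obtain rfl | hyz := eq_or_ne y z
    · rfl
    · rw [hν.integral_sq_eq_two_mul hyz, hν.integral_sq_eq_two_mul hyz.symm]
      simp only [mul_comm]
  obtain rfl | hac := eq_or_ne a c
  · rw [sq_eq a x, one_apply_eq]
    ring
  · rw [one_apply_ne hac, sq_eq x c, hν.integral_sq_eq_two_mul hac.symm]
    ring

theorem sum_integral_diag_mul_diag (hν : HasInvariantSymmetricSecondMoment ν) :
    ∑ p : Fin d × Fin d, ∫ ρ, ρ.1 p.1 p.1 * ρ.1 p.2 p.2 ∂ν = 1 := by
  have := hν.isProbabilityMeasure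
  calc ∑ p : Fin d × Fin d, ∫ ρ, ρ.1 p.1 p.1 * ρ.1 p.2 p.2 ∂ν
      = ∫ ρ, ∑ p : Fin d × Fin d, ρ.1 p.1 p.1 * ρ.1 p.2 p.2 ∂ν :=
        (integral_finsetSum _ fun p _ => integrable_of_continuous (by fun_prop)).symm
    _ = ∫ ρ, ρ.1.trace * ρ.1.trace ∂ν := by
        simp only [trace, diag_apply, Finset.sum_mul_sum, Fintype.sum_prod_type]
    _ = ∫ _, 1 ∂ν := by
        congr with ρ
        rw [ρ.2.2, one_mul]
    _ = 1 := by simp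

theorem integral_diag_mul_diag (hν : HasInvariantSymmetricSecondMoment ν) (a c : Fin d) :
    ∫ ρ, ρ.1 a a * ρ.1 c c ∂ν = (1 + (1 : Matrix (Fin d) (Fin d) ℂ) a c) / (d * (d + 1)) := by
  have hd : (d : ℂ) ≠ 0 := by exact_mod_cast (Fin.pos a).ne'
  have hd1 : (d : ℂ) + 1 ≠ 0 := by exact_mod_cast d.succ_ne_zero
  have sum_one_add : ∑ p : Fin d × Fin d, (1 + (1 : Matrix (Fin d) (Fin d) ℂ) p.1 p.2) =
      d * (d + 1) := by
    rw [Fintype.sum_prod_type]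
    simp [Finset.sum_add_distrib, one_apply, mul_add]
  have normalization := hν.sum_integral_diag_mul_diag
  rw [Finset.sum_congr rfl fun p _ => hν.integral_diag_mul_diag_eq_half_mul a p.1 p.2,
    ← Finset.sum_mul, ← Finset.sum_div, sum_one_add] at normalization
  rw [hν.integral_diag_mul_diag_eq_half_mul a, eq_div_iff (mul_ne_zero hd hd1)]
  linear_combination (1 + (1 : Matrix (Fin d) (Fin d) ℂ) a c) * normalization

theorem isProjectiveTwoDesign (hν : HasInvariantSymmetricSecondMoment ν) :
    IsProjectiveTwoDesign ν := by
  refine ⟨hν.isProbabilityMeasure, fun a b c e => ?_⟩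
  by_cases rows_paired : a = b ∧ c = e
  · obtain ⟨rfl, rfl⟩ := rows_paired
    rw [hν.integral_diag_mul_diag]
    simp only [one_apply]
    grind
  by_cases cross_paired : a = e ∧ c = b
  · obtain ⟨rfl, rfl⟩ := cross_paired
    rw [hν.integral_mul_swap, hν.integral_diag_mul_diag]
    simp only [one_apply]
    grind
  · rw [hν.integral_mul_eq_zero rows_paired cross_paired]
    simp only [one_apply]
    grind

end HasInvariantSymmetricSecondMoment

end SecondMoment

section Haar

variable {d : ℕ}

instance : IsProbabilityMeasure (haarU d) :=
  ⟨Measure.haarMeasure_self⟩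

instance : (haarU d).IsMulLeftInvariant :=
  Measure.isMulLeftInvariant_haarMeasure _

variable {φ : Fin d → ℂ} {hφ : φ ⬝ᵥ star φ = 1}

theorem orbitState_apply (U : UGroup d) (a b : Fin d) :
    (orbitState φ hφ U).1 a b = (U.1 *ᵥ φ) a * star ((U.1 *ᵥ φ) b) :=
  rfl

theorem orbitState_mul (V U : UGroup d) :
    (orbitState φ hφ (V * U)).1 = V.1 * (orbitState φ hφ U).1 * V.1ᴴ := by
  simp only [orbitState, pureState, Submonoid.coe_mul, ← mulVec_mulVec, mul_vecMulVec,
    vecMulVec_mul, star_mulVec V.1]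

theorem continuous_orbitState : Continuous (orbitState φ hφ) := by
  have continuous_mulVec : Continuous fun U : UGroup d => U.1 *ᵥ φ :=
    continuous_subtype_val.matrix_mulVec continuous_const
  exact Continuous.subtype_mk (continuous_mulVec.matrix_vecMulVec continuous_mulVec.star) _

theorem integral_map_orbitState (μ : Measure (UGroup d)) {f : DensityMatrix d → ℂ}
    (hf : Continuous f) :
    ∫ ρ, f ρ ∂(μ.map (orbitState φ hφ)) = ∫ U, f (orbitState φ hφ U) ∂μ :=
  integral_map continuous_orbitState.aemeasurable hf.aestronglyMeasurable

theorem hasInvariantSymmetricSecondMoment_map_haarU :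
    HasInvariantSymmetricSecondMoment ((haarU d).map (orbitState φ hφ)) where
  isProbabilityMeasure := Measure.isProbabilityMeasure_map continuous_orbitState.aemeasurable
  integral_conj_mul_conj V a b c e := by
    rw [integral_map_orbitState _ (by fun_prop), integral_map_orbitState _ (by fun_prop)]
    simpa only [orbitState_mul] using integral_mul_left_eq_self (μ := haarU d)
      (fun U => (orbitState φ hφ U).1 a b * (orbitState φ hφ U).1 c e) V
  integral_mul_swap a b c e := by
    rw [integral_map_orbitState _ (by fun_prop), integral_map_orbitState _ (by fun_prop)]
    simp only [orbitState_apply, mul_mul_mul_comm, mul_comm]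

end Haar

section Design

variable {d : ℕ}

namespace UPolynomial

theorem BidegreeLE.mul {s t : ℕ} {P Q : UPolynomial d} (hP : P.BidegreeLE s)
    (hQ : Q.BidegreeLE t) : (P * Q).BidegreeLE (s + t) := by
  classical
  intro m hm
  obtain ⟨p, hp, q, hq, rfl⟩ := Finset.mem_add.1 (MvPolynomial.support_mul P Q hm)
  simp only [Finsupp.add_apply, Finset.sum_add_distrib]
  exact ⟨add_le_add (hP p hp).1 (hQ q hq).1, add_le_add (hP p hp).2 (hQ q hq).2⟩

theorem evalAt_mul (P Q : UPolynomial d) (U : UGroup d) :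
    (P * Q).evalAt U = P.evalAt U * Q.evalAt U :=
  map_mul _ P Q

/-- The polynomial whose value at `U` is the `(a, b)` entry of `U |φ⟩⟨φ| U†`. -/
noncomputable def orbitEntry (φ : Fin d → ℂ) (a b : Fin d) : UPolynomial d :=
  ∑ p : Fin d × Fin d, MvPolynomial.monomial
    (Finsupp.single (Sum.inl (a, p.1)) 1 + Finsupp.single (Sum.inr (p.2, b)) 1)
    (φ p.1 * star (φ p.2))

theorem bidegreeLE_orbitEntry (φ : Fin d → ℂ) (a b : Fin d) :
    (orbitEntry φ a b).BidegreeLE 1 := by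
  classical
  intro m hm
  obtain ⟨p, -, hp⟩ := Finset.mem_biUnion.1 (MvPolynomial.support_sum hm)
  obtain rfl := Finset.mem_singleton.1 (MvPolynomial.support_monomial_subset hp)
  simp [Finsupp.single_apply]

theorem evalAt_orbitEntry {φ : Fin d → ℂ} (hφ : φ ⬝ᵥ star φ = 1) (a b : Fin d) (U : UGroup d) :
    (orbitEntry φ a b).evalAt U = (orbitState φ hφ U).1 a b := by
  rw [orbitState_apply]
  simp only [mulVec, dotProduct, star_sum, Finset.sum_mul_sum, ← Fintype.sum_prod_type', evalAt,
    orbitEntry, map_sum]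
  refine Finset.sum_congr rfl fun p _ => ?_
  rw [MvPolynomial.eval_monomial, Finsupp.prod_add_index' (by simp) (by simp [pow_add])]
  simp only [Finsupp.prod_single_index, pow_zero, pow_one, Sum.elim_inl, Sum.elim_inr,
    conjTranspose_apply, star_mul']
  ring

end UPolynomial

theorem IsUnitaryDesign.integral_mul_map_orbitState {μ : Measure (UGroup d)}
    (hμ : IsUnitaryDesign 2 μ) {φ : Fin d → ℂ} (hφ : φ ⬝ᵥ star φ = 1) (a b c e : Fin d) :
    ∫ ρ, ρ.1 a b * ρ.1 c e ∂(μ.map (orbitState φ hφ)) =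
      ∫ ρ, ρ.1 a b * ρ.1 c e ∂((haarU d).map (orbitState φ hφ)) := by
  rw [integral_map_orbitState _ (by fun_prop), integral_map_orbitState _ (by fun_prop)]
  simpa only [UPolynomial.evalAt_mul, UPolynomial.evalAt_orbitEntry hφ] using
    hμ.2 _ ((UPolynomial.bidegreeLE_orbitEntry φ a b).mul (UPolynomial.bidegreeLE_orbitEntry φ c e))

theorem IsStateDesign.isProjectiveTwoDesign {ν : Measure (DensityMatrix d)}
    (hν : IsStateDesign 2 ν) : IsProjectiveTwoDesign ν := by
  obtain ⟨φ, hφ, μ, hμ, rfl⟩ := hν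
  have := hμ.1
  refine ⟨Measure.isProbabilityMeasure_map continuous_orbitState.aemeasurable, fun a b c e => ?_⟩
  rw [hμ.integral_mul_map_orbitState hφ]
  exact hasInvariantSymmetricSecondMoment_map_haarU.isProjectiveTwoDesign.integral_mul a b c e

end Design

section Choi

variable {d d' : ℕ}

/-- The Choi matrix of a linear map: the ampliation applied to the maximally entangled state, as in
`Channel.choi`. -/
noncomputable def choiMatrix (T : Matrix (Fin d) (Fin d) ℂ →ₗ[ℂ] Matrix (Fin d') (Fin d') ℂ) :
    Matrix (Fin d' × Fin d) (Fin d' × Fin d) ℂ :=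
  ampliation T d (vecMulVec (maxEntangled d) (star (maxEntangled d)))

variable (T : Matrix (Fin d) (Fin d) ℂ →ₗ[ℂ] Matrix (Fin d') (Fin d') ℂ)

theorem choiMatrix_apply (p q : Fin d' × Fin d) :
    choiMatrix T p q = (d : ℂ)⁻¹ * T (single p.2 q.2 1) p.1 q.1 := by
  have block : Matrix.of (fun i j => vecMulVec (maxEntangled d) (star (maxEntangled d)) (i, p.2)
      (j, q.2)) = (d : ℂ)⁻¹ • single p.2 q.2 1 := by
    have sqrt_inv_mul_self : ((√d : ℝ) : ℂ)⁻¹ * ((√d : ℝ) : ℂ)⁻¹ = (d : ℂ)⁻¹ := by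
      rw [← mul_inv, ← Complex.ofReal_mul, Real.mul_self_sqrt d.cast_nonneg, Complex.ofReal_natCast]
    ext i j
    by_cases hi : p.2 = i <;> by_cases hj : q.2 = j <;>
      simp [vecMulVec_apply, maxEntangled, hi, hj, eq_comm (a := i),
        eq_comm (a := j), sqrt_inv_mul_self]
  rw [choiMatrix, ampliation, of_apply, block, map_smul, Matrix.smul_apply, smul_eq_mul]

theorem sq_smul_partialTraceSnd_choiMatrix_mul_self :
    (d : ℂ) ^ 2 • partialTraceSnd (choiMatrix T * choiMatrix T) =
      ∑ a, ∑ b, T (single a b 1) * T (single b a 1) := by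
  ext p q
  simp only [partialTraceSnd, Matrix.smul_apply, of_apply, mul_apply, choiMatrix_apply,
    Matrix.sum_apply, Fintype.sum_prod_type, smul_eq_mul, Finset.mul_sum]
  refine Finset.sum_congr rfl fun a _ => ?_
  rw [Finset.sum_comm]
  refine Finset.sum_congr rfl fun b _ => Finset.sum_congr rfl fun r _ => ?_
  have : (d : ℂ) ≠ 0 := by exact_mod_cast (Fin.pos a).ne'
  field_simp

end Choi

section TraceDistance

variable {d : ℕ} {ν : Measure (DensityMatrix d)}

theorem traceDist_nonneg (ρ σ : DensityMatrix d) : 0 ≤ traceDist d ρ σ :=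
  mul_nonneg (by norm_num) (traceNorm_nonneg _)

theorem traceDist_le_one (ρ σ : DensityMatrix d) : traceDist d ρ σ ≤ 1 := by
  have := traceNorm_sub_le ρ.2.1 σ.2.1
  rw [ρ.2.2, σ.2.2, Complex.one_re] at this
  rw [traceDist]
  linarith

theorem traceDist_self (ρ : DensityMatrix d) : traceDist d ρ ρ = 0 := by
  simp [traceDist, traceNorm_zero]

@[fun_prop]
theorem continuous_traceDist {X : Type*} [TopologicalSpace X] {f g : X → DensityMatrix d}
    (hf : Continuous f) (hg : Continuous g) : Continuous fun x => traceDist d (f x) (g x) :=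
  continuous_const.mul (continuous_traceNorm.comp (by fun_prop))

theorem trace_sq_le_two_mul_traceDist_sq (ρ σ : DensityMatrix d) :
    ((ρ.1 - σ.1) * (ρ.1 - σ.1)).trace.re ≤ 2 * traceDist d ρ σ ^ 2 := by
  have := two_mul_trace_sq_le_sq_traceNorm (ρ.2.1.1.sub σ.2.1.1)
    (by rw [trace_sub, ρ.2.2, σ.2.2, sub_self])
  rw [traceDist]
  linarith

theorem integral_trace_sub_mul_sub (hν : IsProjectiveTwoDesign ν) :
    ∫ q, ((q.1.1 - q.2.1) * (q.1.1 - q.2.1)).trace ∂(ν.prod ν) = 2 * (1 - 1 / d) := by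
  have := hν.dim_ne_zero
  have hd : (d : ℂ) + 1 ≠ 0 := by exact_mod_cast d.succ_ne_zero
  refine (hν.integral_map_map_sub_sub
    ((LinearMap.mul ℂ (Matrix (Fin d) (Fin d) ℂ)).compr₂ (traceLinearMap _ ℂ ℂ))).trans ?_
  simp
  field_simp
  ring

theorem integral_one_sub_traceDist_sq_le (hν : IsProjectiveTwoDesign ν) :
    ∫ q, (1 - traceDist d q.1 q.2 ^ 2) ∂(ν.prod ν) ≤ 1 / (d : ℝ) := by
  have := hν.isProbabilityMeasure
  calc ∫ q, (1 - traceDist d q.1 q.2 ^ 2) ∂(ν.prod ν)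
      ≤ ∫ q, (1 - 1 / 2 * ((q.1.1 - q.2.1) * (q.1.1 - q.2.1)).trace.re) ∂(ν.prod ν) := by
        refine integral_mono (integrable_of_continuous (by fun_prop))
          (integrable_of_continuous (by fun_prop)) fun q => ?_
        have := trace_sq_le_two_mul_traceDist_sq q.1 q.2
        dsimp only
        linarith
    _ = 1 - 1 / 2 * (∫ q, ((q.1.1 - q.2.1) * (q.1.1 - q.2.1)).trace ∂(ν.prod ν)).re := by
        have trace_integrable : Integrable (fun q : DensityMatrix d × DensityMatrix d =>
            ((q.1.1 - q.2.1) * (q.1.1 - q.2.1)).trace) (ν.prod ν) :=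
          integrable_of_continuous (by fun_prop)
        have re_integrable : Integrable (fun q : DensityMatrix d × DensityMatrix d =>
            1 / 2 * ((q.1.1 - q.2.1) * (q.1.1 - q.2.1)).trace.re) (ν.prod ν) :=
          integrable_of_continuous (by fun_prop)
        rw [integral_sub (integrable_const 1) re_integrable, integral_const_mul, integral_const,
          probReal_univ, one_smul]
        exact congrArg (1 - 1 / 2 * ·) (integral_re trace_integrable)
    _ = 1 / (d : ℝ) := by
        rw [integral_trace_sub_mul_sub hν]
        simp [← Complex.ofReal_natCast, ← Complex.ofReal_inv]

theorem measurableSet_ne :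
    MeasurableSet {q : DensityMatrix d × DensityMatrix d | q.1 ≠ q.2} :=
  (measurableSet_eq_fun measurable_fst measurable_snd).compl

theorem measureReal_compl_ne_le (hν : IsProjectiveTwoDesign ν) :
    (ν.prod ν).real {q | q.1 ≠ q.2}ᶜ ≤ 1 / (d : ℝ) := by
  have := hν.isProbabilityMeasure
  calc (ν.prod ν).real {q | q.1 ≠ q.2}ᶜ
      ≤ (ν.prod ν).real {q | 1 ≤ 1 - traceDist d q.1 q.2 ^ 2} := by
        refine measureReal_mono fun q hq => ?_
        simp [not_not.1 hq, traceDist_self]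
    _ ≤ ∫ q, (1 - traceDist d q.1 q.2 ^ 2) ∂(ν.prod ν) := by
        rw [← one_mul ((ν.prod ν).real _)]
        refine mul_meas_ge_le_integral_of_nonneg (.of_forall fun q => ?_)
          (integrable_of_continuous (by fun_prop)) 1
        exact sub_nonneg.2 (pow_le_one₀ (traceDist_nonneg _ _) (traceDist_le_one _ _))
    _ ≤ 1 / (d : ℝ) := integral_one_sub_traceDist_sq_le hν

end TraceDistance

section Contraction

theorem div_le_add_one_sub {a b : ℝ} (ha : 0 ≤ a) (hab : a ≤ b) (hb : b ≤ 1) :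
    a / b ≤ a + (1 - b) := by
  obtain rfl | hb0 := (ha.trans hab).eq_or_lt
  · simp [ha, add_nonneg]
  · rw [div_le_iff₀ hb0]
    nlinarith [mul_nonneg (sub_nonneg.2 hab) (sub_nonneg.2 hb)]

theorem integral_cond_le_integral_add {Ω : Type*} [MeasurableSpace Ω] {m : Measure Ω}
    [IsProbabilityMeasure m] {S : Set Ω} (hS : MeasurableSet S) {f : Ω → ℝ}
    (hf : Integrable f m) (hf0 : ∀ x, 0 ≤ f x) (hf1 : ∀ x, f x ≤ 1) :
    ∫ x, f x ∂(ProbabilityTheory.cond m S) ≤ ∫ x, f x ∂m + m.real Sᶜ := by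
  have setIntegral_le_measure : ∫ x in S, f x ∂m ≤ m.real S := by
    simpa using setIntegral_mono_on hf.integrableOn (integrable_const (1 : ℝ)).integrableOn hS
      fun x _ => hf1 x
  calc ∫ x, f x ∂(ProbabilityTheory.cond m S) = (∫ x in S, f x ∂m) / m.real S := by
        rw [ProbabilityTheory.cond, integral_smul_measure, ENNReal.toReal_inv, smul_eq_mul,
          inv_mul_eq_div, Measure.real]
    _ ≤ ∫ x in S, f x ∂m + (1 - m.real S) :=
        div_le_add_one_sub (setIntegral_nonneg hS fun x _ => hf0 x) setIntegral_le_measure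
          measureReal_le_one
    _ ≤ ∫ x, f x ∂m + m.real Sᶜ := by
        rw [probReal_compl_eq_one_sub hS]
        gcongr ?_ + _
        exact setIntegral_le_integral hf (.of_forall hf0)

variable {d d' : ℕ}

/-- The factor by which a linear map contracts the trace distance of a pair of states; on pairs of
equal states it takes the junk value `0 / 0 = 0`. -/
noncomputable def traceContractionRatio
    (T : Matrix (Fin d) (Fin d) ℂ →ₗ[ℂ] Matrix (Fin d') (Fin d') ℂ)
    (q : DensityMatrix d × DensityMatrix d) : ℝ :=
  1 / 2 * traceNorm (T (q.1.1 - q.2.1)) / traceDist d q.1 q.2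

theorem contractionRatio_traceDist (T : Channel d d') :
    contractionRatio traceDist T = traceContractionRatio T.toLin := by
  ext q
  rw [contractionRatio, traceContractionRatio, map_sub]
  rfl

theorem contractionMoment_one (T : Channel d d')
    (D : ∀ n : ℕ, DensityMatrix n → DensityMatrix n → ℝ)
    (m : Measure (DensityMatrix d × DensityMatrix d)) :
    contractionMoment 1 T D m = ∫ q, contractionRatio D T q ∂m := by
  simp only [contractionMoment, Real.rpow_one, div_one]

variable {T : Matrix (Fin d) (Fin d) ℂ →ₗ[ℂ] Matrix (Fin d') (Fin d') ℂ}

@[fun_prop]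
theorem continuous_map (T : Matrix (Fin d) (Fin d) ℂ →ₗ[ℂ] Matrix (Fin d') (Fin d') ℂ) :
    Continuous T :=
  T.continuous_of_finiteDimensional

theorem traceContractionRatio_nonneg
    (T : Matrix (Fin d) (Fin d) ℂ →ₗ[ℂ] Matrix (Fin d') (Fin d') ℂ)
    (q : DensityMatrix d × DensityMatrix d) : 0 ≤ traceContractionRatio T q :=
  div_nonneg (mul_nonneg (by norm_num) (traceNorm_nonneg _)) (traceDist_nonneg _ _)

namespace IsPositiveTracePreserving

variable (hT : IsPositiveTracePreserving T)

include hT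

theorem half_traceNorm_map_sub_le (q : DensityMatrix d × DensityMatrix d) :
    1 / 2 * traceNorm (T (q.1.1 - q.2.1)) ≤ traceDist d q.1 q.2 :=
  mul_le_mul_of_nonneg_left (hT.traceNorm_map_le (q.1.2.1.1.sub q.2.2.1.1)) (by norm_num)

theorem traceContractionRatio_le_one (q : DensityMatrix d × DensityMatrix d) :
    traceContractionRatio T q ≤ 1 :=
  div_le_one_of_le₀ (hT.half_traceNorm_map_sub_le q) (traceDist_nonneg _ _)

theorem traceContractionRatio_le_add (q : DensityMatrix d × DensityMatrix d) :
    traceContractionRatio T q ≤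
      1 / 2 * traceNorm (T (q.1.1 - q.2.1)) + (1 - traceDist d q.1 q.2 ^ 2) := by
  refine (div_le_add_one_sub (mul_nonneg (by norm_num) (traceNorm_nonneg _))
    (hT.half_traceNorm_map_sub_le q) (traceDist_le_one _ _)).trans ?_
  gcongr
  exact pow_le_of_le_one (traceDist_nonneg _ _) (traceDist_le_one _ _) two_ne_zero

theorem integrable_traceContractionRatio (m : Measure (DensityMatrix d × DensityMatrix d))
    [IsFiniteMeasure m] : Integrable (traceContractionRatio T) m := by
  have measurable_ratio : Measurable (traceContractionRatio T) :=
    Measurable.div (Continuous.measurable (by fun_prop)) (Continuous.measurable (by fun_prop))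
  refine .of_bound measurable_ratio.aestronglyMeasurable 1 (.of_forall fun q => ?_)
  rw [Real.norm_of_nonneg (traceContractionRatio_nonneg T q)]
  exact hT.traceContractionRatio_le_one q

end IsPositiveTracePreserving

variable {ν : Measure (DensityMatrix d)}

section SecondMoment

open scoped Matrix.Norms.L2Operator

theorem integral_map_sub_mul_map_sub (hν : IsProjectiveTwoDesign ν)
    (T : Matrix (Fin d) (Fin d) ℂ →ₗ[ℂ] Matrix (Fin d') (Fin d') ℂ) :
    ∫ q, T (q.1.1 - q.2.1) * T (q.1.1 - q.2.1) ∂(ν.prod ν) =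
      (2 / ((d : ℂ) + 1)) • ((d : ℂ) • partialTraceSnd (choiMatrix T * choiMatrix T) -
        T ((d : ℂ)⁻¹ • 1) * T ((d : ℂ)⁻¹ • 1)) := by
  have := hν.dim_ne_zero
  have hd : (d : ℂ) + 1 ≠ 0 := by exact_mod_cast d.succ_ne_zero
  refine (hν.integral_map_map_sub_sub
    ((LinearMap.mul ℂ (Matrix (Fin d') (Fin d') ℂ)).compl₁₂ T T)).trans ?_
  simp only [LinearMap.compl₁₂_apply, LinearMap.mul_apply', map_smul,
    ← sq_smul_partialTraceSnd_choiMatrix_mul_self, smul_mul_smul_comm, smul_sub, smul_smul]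
  congr 2 <;> field_simp

theorem integral_traceNorm_map_sub_le (hν : IsProjectiveTwoDesign ν)
    (hT : IsPositiveTracePreserving T) :
    ∫ q, traceNorm (T (q.1.1 - q.2.1)) ∂(ν.prod ν) ≤
      (matrixSqrt ((2 / ((d : ℂ) + 1)) •
        ((d : ℂ) • partialTraceSnd (choiMatrix T * choiMatrix T) -
          T ((d : ℂ)⁻¹ • 1) * T ((d : ℂ)⁻¹ • 1)))).trace.re := by
  have := hν.isProbabilityMeasure
  rw [← integral_map_sub_mul_map_sub hν T]
  have sq_eq (q : DensityMatrix d × DensityMatrix d) :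
      T (q.1.1 - q.2.1) * T (q.1.1 - q.2.1) = (T (q.1.1 - q.2.1))ᴴ * T (q.1.1 - q.2.1) := by
    rw [hT.isHermitian_map_sub q.1 q.2]
  simp only [sq_eq]
  refine integral_re_trace_matrixSqrt_le (fun q => ?_) (integrable_of_continuous (by fun_prop))
    (integrable_of_continuous (continuous_traceNorm.comp (by fun_prop)))
  exact nonneg_iff_posSemidef.2 (posSemidef_conjTranspose_mul_self _)

end SecondMoment

theorem integral_traceContractionRatio_le (hν : IsProjectiveTwoDesign ν)
    (hT : IsPositiveTracePreserving T) :
    ∫ q, traceContractionRatio T q ∂(ν.prod ν) ≤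
      1 / 2 * (matrixSqrt ((2 / ((d : ℂ) + 1)) •
        ((d : ℂ) • partialTraceSnd (choiMatrix T * choiMatrix T) -
          T ((d : ℂ)⁻¹ • 1) * T ((d : ℂ)⁻¹ • 1)))).trace.re + 1 / d := by
  have := hν.isProbabilityMeasure
  calc ∫ q, traceContractionRatio T q ∂(ν.prod ν)
      ≤ ∫ q, (1 / 2 * traceNorm (T (q.1.1 - q.2.1)) + (1 - traceDist d q.1 q.2 ^ 2))
          ∂(ν.prod ν) := by
        exact integral_mono (hT.integrable_traceContractionRatio _)
          (integrable_of_continuous (by fun_prop)) hT.traceContractionRatio_le_add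
    _ = 1 / 2 * ∫ q, traceNorm (T (q.1.1 - q.2.1)) ∂(ν.prod ν) +
          ∫ q, (1 - traceDist d q.1 q.2 ^ 2) ∂(ν.prod ν) := by
        rw [integral_add (integrable_of_continuous _) (integrable_of_continuous _),
          integral_const_mul] <;> fun_prop
    _ ≤ _ := by
        gcongr
        · exact integral_traceNorm_map_sub_le hν hT
        · exact integral_one_sub_traceDist_sq_le hν

theorem isProbabilityMeasure_distinctPair (hν : IsProjectiveTwoDesign ν) (hd : 2 ≤ d) :
    IsProbabilityMeasure (distinctPair ν) := by
  have := hν.isProbabilityMeasure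
  refine ProbabilityTheory.cond_isProbabilityMeasure fun measure_ne_eq_zero => ?_
  have compl_measure_le := measureReal_compl_ne_le hν
  rw [probReal_compl_eq_one_sub measurableSet_ne, Measure.real, measure_ne_eq_zero,
    ENNReal.toReal_zero, sub_zero, le_div_iff₀ (by positivity)] at compl_measure_le
  have : (2 : ℝ) ≤ d := by exact_mod_cast hd
  linarith

end Contraction

end QuantumContraction

theorem mainTheorem7_general {d d' : ℕ} (hd : 2 ≤ d)
    {T : Matrix (Fin d) (Fin d) ℂ →ₗ[ℂ] Matrix (Fin d') (Fin d') ℂ}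
    (hT : IsPositiveTracePreserving T) {ν : Measure (DensityMatrix d)}
    (hν : IsProjectiveTwoDesign ν) :
    IsProbabilityMeasure (distinctPair ν) ∧
      Integrable (traceContractionRatio T) (distinctPair ν) ∧
      ∫ q, traceContractionRatio T q ∂(distinctPair ν) ≤
        1 / 2 * (matrixSqrt ((2 / ((d : ℂ) + 1)) •
          ((d : ℂ) • partialTraceSnd (choiMatrix T * choiMatrix T) -
            T ((d : ℂ)⁻¹ • 1) * T ((d : ℂ)⁻¹ • 1)))).trace.re + 2 / d := by
  have := hν.isProbabilityMeasure
  have := isProbabilityMeasure_distinctPair hν hd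
  refine ⟨this, hT.integrable_traceContractionRatio _, ?_⟩
  have conditioning := integral_cond_le_integral_add measurableSet_ne
    (hT.integrable_traceContractionRatio (ν.prod ν)) (traceContractionRatio_nonneg T)
    hT.traceContractionRatio_le_one
  have unconditioned := integral_traceContractionRatio_le hν hT
  have compl_measure_le := measureReal_compl_ne_le hν
  calc ∫ q, traceContractionRatio T q ∂(distinctPair ν) ≤ _ := conditioning
    _ ≤ _ := add_le_add unconditioned compl_measure_le
    _ = _ := by ring

theorem mainTheorem7 :
    ∃ C : ℝ, ∀ (d d' : ℕ), 2 ≤ d → ∀ (T : Channel d d') (ν : Measure (DensityMatrix d)),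
      IsStateDesign 2 ν →
        IsProbabilityMeasure (distinctPair ν) ∧
        Integrable (contractionRatio traceDist T) (distinctPair ν) ∧
        contractionMoment 1 T traceDist (distinctPair ν) ≤
          1 / 2 * (matrixSqrt ((2 / ((d : ℂ) + 1)) •
            ((d : ℂ) • partialTraceSnd (T.choi * T.choi) - T.avgOutput * T.avgOutput))).trace.re
            + C / Real.sqrt d := by
  refine ⟨2, fun d d' hd T ν hν => ?_⟩
  rw [contractionMoment_one, contractionRatio_traceDist]
  obtain ⟨isProbabilityMeasure, integrable, contraction_le⟩ :=
    mainTheorem7_general hd T.isPositiveTracePreserving hν.isProjectiveTwoDesign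
  refine ⟨isProbabilityMeasure, integrable, contraction_le.trans (add_le_add le_rfl ?_)⟩
  have one_le_d : (1 : ℝ) ≤ d := by exact_mod_cast one_le_two.trans hd
  have sqrt_le_self : Real.sqrt d ≤ d :=
    Real.sqrt_le_iff.2 ⟨by positivity, le_self_pow₀ one_le_d two_ne_zero⟩
  gcongr
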